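/- For a unit vector $q\in\mathbb{R}^n$ let $P_q$ denote the orthogonal projection of $\mathbb{R}^n$ onto the hyperplane $\{z\in\mathbb{R}^n : \langle q,z\rangle=0\}$. A convex compact set $A\subset\mathbb{R}^n$ is called a $P$-set if, for every unit vector $q\in\mathbb{R}^n$, the function $$f_{A,q}\colon P_qA\to\mathbb{R},\qquad f_{A,q}(x)=\min\{\mu\in\mathbb{R} : x+\mu q\in A\},$$ is continuous on $P_qA$. Theorem. A convex compact set $A\subset\mathbb{R}^n$ is a $P$-set if and only if, for every natural number $m$ and every linear map $L\colon\mathbb{R}^n\to\mathbb{R}^m$, the map $L\colon A\to LA$ is open, where $A$ and $LA$ carry the topologies induced from $\mathbb{R}^n$ and $\mathbb{R}^m$. -/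

import Mathlib

/-- The hyperplane `{z | ⟨q, z⟩ = 0}` of `ℝⁿ`, as a linear subspace. -/
noncomputable def orthHyperplane {n : ℕ} (q : EuclideanSpace ℝ (Fin n)) :
    Submodule ℝ (EuclideanSpace ℝ (Fin n)) :=
  (Submodule.span ℝ {q})ᗮ

/-- The orthogonal projection of `ℝⁿ` onto the hyperplane `{z | ⟨q, z⟩ = 0}`. -/
noncomputable def projHyperplane {n : ℕ} (q : EuclideanSpace ℝ (Fin n)) :
    EuclideanSpace ℝ (Fin n) →L[ℝ] orthHyperplane q :=
  (Submodule.span ℝ {q})ᗮ.orthogonalProjectionOnto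

/-- The function `x ↦ min {μ | x + μ q ∈ A}`, which is used for `x` in the projection of `A`
onto the hyperplane orthogonal to `q`. The infimum is a minimum there for compact `A` and
unit vectors `q`, see `isLeast_lowerFunction`. -/
noncomputable def lowerFunction {n : ℕ} (A : Set (EuclideanSpace ℝ (Fin n)))
    (q : EuclideanSpace ℝ (Fin n)) (x : orthHyperplane q) : ℝ :=
  sInf {μ : ℝ | (x : EuclideanSpace ℝ (Fin n)) + μ • q ∈ A}

/-- The infimum in `lowerFunction` is attained. -/
theorem isLeast_lowerFunction {n : ℕ} {A : Set (EuclideanSpace ℝ (Fin n))} (hA : IsCompact A)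
    {q : EuclideanSpace ℝ (Fin n)} (hq : ‖q‖ = 1) {x : orthHyperplane q}
    (hx : x ∈ projHyperplane q '' A) :
    IsLeast {μ : ℝ | (x : EuclideanSpace ℝ (Fin n)) + μ • q ∈ A} (lowerFunction A q x) := by
  have hcont : Continuous fun μ : ℝ => (x : EuclideanSpace ℝ (Fin n)) + μ • q := by fun_prop
  have hclosed : IsClosed {μ : ℝ | (x : EuclideanSpace ℝ (Fin n)) + μ • q ∈ A} :=
    hA.isClosed.preimage hcont
  have hne : {μ : ℝ | (x : EuclideanSpace ℝ (Fin n)) + μ • q ∈ A}.Nonempty := by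
    obtain ⟨z, hz, rfl⟩ := hx
    refine ⟨inner ℝ q z, ?_⟩
    have h1 := Submodule.starProjection_add_starProjection_orthogonal (K := Submodule.span ℝ {q}) z
    rw [Submodule.starProjection_unit_singleton ℝ hq] at h1
    have h2 : ((projHyperplane q z : orthHyperplane q) : EuclideanSpace ℝ (Fin n))
        = (Submodule.span ℝ {q})ᗮ.starProjection z := rfl
    rw [Set.mem_ofPred_eq, h2, add_comm, h1]
    exact hz
  have hbdd : BddBelow {μ : ℝ | (x : EuclideanSpace ℝ (Fin n)) + μ • q ∈ A} := by
    obtain ⟨C, hC⟩ := hA.isBounded.exists_norm_le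
    refine ⟨-(C + ‖(x : EuclideanSpace ℝ (Fin n))‖), fun μ hμ => ?_⟩
    have h3 : ‖μ • q‖ ≤ C + ‖(x : EuclideanSpace ℝ (Fin n))‖ := by
      have h4 := norm_sub_le ((x : EuclideanSpace ℝ (Fin n)) + μ • q) x
      rw [add_sub_cancel_left] at h4
      linarith [hC _ hμ]
    rw [norm_smul, hq, mul_one, Real.norm_eq_abs] at h3
    linarith [neg_abs_le μ]
  exact ⟨hclosed.csInf_mem hne hbdd, fun μ hμ => csInf_le hbdd hμ⟩

/-- `P`-sets: convex compact sets `A` in `ℝⁿ` such that, for every unit vector `q`, the function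
`x ↦ min {μ | x + μ q ∈ A}` is continuous on the projection of `A` onto the hyperplane
orthogonal to `q`. -/
def IsPSet {n : ℕ} (A : Set (EuclideanSpace ℝ (Fin n))) : Prop :=
  Convex ℝ A ∧ IsCompact A ∧
    ∀ q : EuclideanSpace ℝ (Fin n), ‖q‖ = 1 →
      ContinuousOn (lowerFunction A q) (projHyperplane q '' A)

open Topology Filter Set

/-! Openness is tested pointwise, with neighbourhoods within the image. For a `P`-set, the fibres of
a projection along `q` are segments whose two endpoints vary continuously, so each point of `A` lies
on a continuous local section; hence such projections are open. A general `L` reduces to a single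
direction in its kernel by compactness (`IsPSet.image_linearMap_mem_nhdsWithin`). Conversely,
openness of the projections gives upper semicontinuity of the minimum, while compactness alone gives
lower semicontinuity. -/

theorem isOpenMap_imageFactorization_iff {X Y : Type*} [TopologicalSpace X] [TopologicalSpace Y]
    {f : X → Y} {A : Set X} :
    IsOpenMap (imageFactorization f A) ↔
      ∀ z ∈ A, ∀ U ∈ 𝓝 z, f '' (A ∩ U) ∈ 𝓝[f '' A] (f z) := by
  have himage : ∀ U : Set X, ((↑) : f '' A → Y) '' (imageFactorization f A '' ((↑) ⁻¹' U)) =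
      f '' (A ∩ U) := by
    intro U
    ext y
    constructor
    · rintro ⟨_, ⟨x, hx, rfl⟩, rfl⟩
      exact ⟨x, ⟨x.2, hx⟩, rfl⟩
    · rintro ⟨x, ⟨hxA, hxU⟩, rfl⟩
      exact ⟨_, ⟨⟨x, hxA⟩, hxU, rfl⟩, rfl⟩
  rw [isOpenMap_iff_nhds_le]
  constructor
  · intro h z hz U hU
    have h1 : imageFactorization f A '' ((↑) ⁻¹' U) ∈ 𝓝 (imageFactorization f A ⟨z, hz⟩) :=
      h ⟨z, hz⟩ (image_mem_map (continuous_subtype_val.continuousAt hU))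
    have h2 := image_mem_map (m := ((↑) : f '' A → Y)) h1
    rwa [himage, map_nhds_subtype_val] at h2
  · rintro h ⟨z, hz⟩ S hS
    rw [mem_map, nhds_subtype, mem_comap] at hS
    obtain ⟨U, hU, hUS⟩ := hS
    have h1 := h z hz U hU
    have h2 : imageFactorization f A ⟨z, hz⟩ = ⟨f z, mem_image_of_mem f hz⟩ := rfl
    rw [h2, nhds_subtype_eq_comap_nhdsWithin]
    refine ⟨_, h1, ?_⟩
    rw [← himage U, preimage_image_eq _ Subtype.val_injective]
    exact image_subset_iff.2 hUS

section Projection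

variable {n : ℕ} {A : Set (EuclideanSpace ℝ (Fin n))} {q : EuclideanSpace ℝ (Fin n)}

theorem coe_projHyperplane (hq : ‖q‖ = 1) (z : EuclideanSpace ℝ (Fin n)) :
    (projHyperplane q z : EuclideanSpace ℝ (Fin n)) = z - inner ℝ q z • q := by
  have h1 := Submodule.starProjection_add_starProjection_orthogonal (K := Submodule.span ℝ {q}) z
  rw [Submodule.starProjection_unit_singleton ℝ hq] at h1
  exact eq_sub_of_add_eq' h1

theorem coe_projHyperplane_add (hq : ‖q‖ = 1) (z : EuclideanSpace ℝ (Fin n)) :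
    (projHyperplane q z : EuclideanSpace ℝ (Fin n)) + inner ℝ q z • q = z := by
  rw [coe_projHyperplane hq, sub_add_cancel]

theorem inner_coe_orthHyperplane (x : orthHyperplane q) :
    inner ℝ q (x : EuclideanSpace ℝ (Fin n)) = 0 :=
  Submodule.mem_orthogonal_singleton_iff_inner_right.1 x.2

theorem inner_coe_add_smul (hq : ‖q‖ = 1) (x : orthHyperplane q) (μ : ℝ) :
    inner ℝ q ((x : EuclideanSpace ℝ (Fin n)) + μ • q) = μ := by
  rw [inner_add_right, inner_coe_orthHyperplane, inner_smul_right, real_inner_self_eq_norm_sq, hq]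
  norm_num

theorem projHyperplane_coe_add_smul (hq : ‖q‖ = 1) (x : orthHyperplane q) (μ : ℝ) :
    projHyperplane q ((x : EuclideanSpace ℝ (Fin n)) + μ • q) = x := by
  apply Subtype.ext
  rw [coe_projHyperplane hq, inner_coe_add_smul hq, add_sub_cancel_right]

/-- The largest `μ` with `x + μ q ∈ A`, expressed through the direction `-q`. -/
theorem exists_isGreatest_continuousWithinAt (hA : IsPSet A) (hq : ‖q‖ = 1)
    {x₀ : orthHyperplane q} (hx₀ : x₀ ∈ projHyperplane q '' A) :
    ∃ g : orthHyperplane q → ℝ, ContinuousWithinAt g (projHyperplane q '' A) x₀ ∧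
      ∀ x ∈ projHyperplane q '' A,
        IsGreatest {μ : ℝ | (x : EuclideanSpace ℝ (Fin n)) + μ • q ∈ A} (g x) := by
  have hq' : ‖-q‖ = 1 := by rwa [norm_neg]
  have hmem : ∀ x : orthHyperplane q, (x : EuclideanSpace ℝ (Fin n)) ∈ orthHyperplane (-q) := by
    intro x
    refine Submodule.mem_orthogonal_singleton_iff_inner_right.2 ?_
    rw [inner_neg_left, inner_coe_orthHyperplane, neg_zero]
  let φ : orthHyperplane q → orthHyperplane (-q) := fun x => ⟨x, hmem x⟩
  have hφ : Continuous φ := continuous_subtype_val.subtype_mk _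
  have hmaps : MapsTo φ (projHyperplane q '' A) (projHyperplane (-q) '' A) := by
    rintro _ ⟨z, hz, rfl⟩
    refine ⟨z, hz, Subtype.ext ?_⟩
    change _ = (projHyperplane q z : EuclideanSpace ℝ (Fin n))
    rw [coe_projHyperplane hq, coe_projHyperplane hq', inner_neg_left, neg_smul_neg]
  refine ⟨fun x => -lowerFunction A (-q) (φ x), ?_, fun x hx => ?_⟩
  · exact ((hA.2.2 (-q) hq' _ (hmaps hx₀)).comp hφ.continuousWithinAt hmaps).neg
  · obtain ⟨h1, h2⟩ := isLeast_lowerFunction hA.2.1 hq' (hmaps hx)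
    refine ⟨?_, fun μ hμ => ?_⟩
    · rw [mem_ofPred_eq, smul_neg, ← neg_smul] at h1
      exact h1
    · have h3 : -μ ∈ {μ : ℝ | (φ x : EuclideanSpace ℝ (Fin n)) + μ • -q ∈ A} := by
        rw [mem_ofPred_eq, neg_smul_neg]
        exact hμ
      linarith [h2 h3]

/-- The height of `z` along `q`, clamped between the lower and upper endpoints of each fibre, gives
a continuous section through `z`; convexity keeps it in `A`. -/
theorem IsPSet.image_projHyperplane_mem_nhdsWithin (hA : IsPSet A) (hq : ‖q‖ = 1)
    {z : EuclideanSpace ℝ (Fin n)} (hz : z ∈ A) {U : Set (EuclideanSpace ℝ (Fin n))}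
    (hU : U ∈ 𝓝 z) :
    projHyperplane q '' (A ∩ U) ∈ 𝓝[projHyperplane q '' A] (projHyperplane q z) := by
  have hx₀ := mem_image_of_mem (projHyperplane q) hz
  obtain ⟨g, hg, hgreat⟩ := exists_isGreatest_continuousWithinAt hA hq hx₀
  have hf := hA.2.2 q hq _ hx₀
  have hleast := fun x hx => isLeast_lowerFunction hA.2.1 hq (x := x) hx
  set f := lowerFunction A q
  set c : ℝ := inner ℝ q z
  have hc : c ∈ {μ : ℝ | (projHyperplane q z : EuclideanSpace ℝ (Fin n)) + μ • q ∈ A} := by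
    rw [mem_ofPred_eq, coe_projHyperplane_add hq]
    exact hz
  let s : orthHyperplane q → EuclideanSpace ℝ (Fin n) :=
    fun x => (x : EuclideanSpace ℝ (Fin n)) + max (f x) (min c (g x)) • q
  have hs : ContinuousWithinAt s (projHyperplane q '' A) (projHyperplane q z) :=
    continuous_subtype_val.continuousWithinAt.add
      ((hf.max (continuousWithinAt_const.min hg)).smul continuousWithinAt_const)
  have hsz : s (projHyperplane q z) = z := by
    change _ + max _ (min c _) • q = z
    rw [min_eq_left ((hgreat _ hx₀).2 hc), max_eq_right ((hleast _ hx₀).2 hc),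
      coe_projHyperplane_add hq]
  have hU' : U ∈ 𝓝 (s (projHyperplane q z)) := by rwa [hsz]
  filter_upwards [hs hU', self_mem_nhdsWithin] with x hxU hx
  refine ⟨s x, ⟨?_, hxU⟩, projHyperplane_coe_add_smul hq _ _⟩
  have hline : Convex ℝ {μ : ℝ | (x : EuclideanSpace ℝ (Fin n)) + μ • q ∈ A} := by
    intro μ hμ ν hν a b ha hb hab
    have h := hA.1 hμ hν ha hb hab
    rw [mem_ofPred_eq]
    convert h using 1
    calc (x : EuclideanSpace ℝ (Fin n)) + (a • μ + b • ν) • q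
        = (a + b) • (x : EuclideanSpace ℝ (Fin n)) + (a • μ + b • ν) • q := by
          rw [hab, one_smul]
      _ = _ := by
          simp only [smul_eq_mul]
          module
  exact hline.ordConnected.out (hleast x hx).1 (hgreat x hx).1
    ⟨le_max_left _ _, max_le ((hleast x hx).2 (hgreat x hx).1) (min_le_right _ _)⟩

theorem IsPSet.image_linearMap_mem_nhdsWithin (hA : IsPSet A) {F : Type*}
    [NormedAddCommGroup F] [NormedSpace ℝ F] (L : EuclideanSpace ℝ (Fin n) →ₗ[ℝ] F)
    {z : EuclideanSpace ℝ (Fin n)} (hz : z ∈ A) {U : Set (EuclideanSpace ℝ (Fin n))}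
    (hU : U ∈ 𝓝 z) :
    L '' (A ∩ U) ∈ 𝓝[L '' A] (L z) := by
  have hL : Continuous L := L.continuous_of_finiteDimensional
  -- The bad points: it suffices that `L z` avoids the compact set `L '' closure B`.
  set B : Set (EuclideanSpace ℝ (Fin n)) := {w | w ∈ A ∧ L w ∉ L '' (A ∩ U)}
  have hBA : B ⊆ A := fun w hw => hw.1
  have hcB : IsCompact (closure B) := hA.2.1.closure_of_subset hBA
  have hnot : L z ∉ L '' closure B := by
    rintro ⟨w, hw, hwz⟩
    by_cases hne : z - w = 0
    · obtain rfl := sub_eq_zero.1 hne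
      obtain ⟨b, hbU, hbB⟩ := mem_closure_iff_nhds.1 hw U hU
      exact hbB.2 ⟨b, ⟨hbB.1, hbU⟩, rfl⟩
    -- Since `q` lies in the kernel of `L` and `z`, `w` project alike along it, a bad point near `w`
    -- shares its projection, hence its `L`-value, with a point of `A ∩ U`.
    · set q : EuclideanSpace ℝ (Fin n) := ‖z - w‖⁻¹ • (z - w) with hqdef
      have hnorm : ‖z - w‖ ≠ 0 := norm_ne_zero_iff.2 hne
      have hq : ‖q‖ = 1 := by
        rw [hqdef, norm_smul, norm_inv, norm_norm, inv_mul_cancel₀ hnorm]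
      have hLq : L q = 0 := by rw [hqdef, map_smul, map_sub, hwz, sub_self, smul_zero]
      have hzw : z = w + ‖z - w‖ • q := by
        rw [hqdef, smul_inv_smul₀ hnorm, add_sub_cancel]
      have hPq : projHyperplane q q = 0 := by
        apply Subtype.ext
        rw [coe_projHyperplane hq, real_inner_self_eq_norm_sq, hq]
        simp
      have hP : projHyperplane q z = projHyperplane q w := by
        conv_lhs => rw [hzw]
        rw [map_add, map_smul, hPq, smul_zero, add_zero]
      have h1 := hA.image_projHyperplane_mem_nhdsWithin hq hz hU
      rw [hP] at h1
      obtain ⟨V, hV, hVsub⟩ := mem_nhdsWithin_iff_exists_mem_nhds_inter.1 h1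
      obtain ⟨b, hbV, hbB⟩ := mem_closure_iff_nhds.1 hw _
        ((projHyperplane q).continuous.continuousAt hV)
      obtain ⟨u, hu, hub⟩ := hVsub ⟨hbV, mem_image_of_mem _ hbB.1⟩
      refine hbB.2 ⟨u, hu, ?_⟩
      rw [← coe_projHyperplane_add hq u, ← coe_projHyperplane_add hq b, hub]
      simp only [map_add, map_smul, hLq, smul_zero]
  filter_upwards [mem_nhdsWithin_of_mem_nhds
    ((hcB.image hL).isClosed.isOpen_compl.mem_nhds hnot), self_mem_nhdsWithin]
  rintro _ hy ⟨w, hw, rfl⟩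
  by_contra hcon
  exact hy ⟨w, subset_closure ⟨hw, hcon⟩, rfl⟩

theorem continuousOn_lowerFunction (hA : IsCompact A) (hq : ‖q‖ = 1)
    (hopen : ∀ z ∈ A, ∀ U ∈ 𝓝 z,
      projHyperplane q '' (A ∩ U) ∈ 𝓝[projHyperplane q '' A] (projHyperplane q z)) :
    ContinuousOn (lowerFunction A q) (projHyperplane q '' A) := by
  intro x₀ hx₀
  have hleast := fun x hx => isLeast_lowerFunction hA hq (x := x) hx
  have hinner : Continuous fun z : EuclideanSpace ℝ (Fin n) => inner ℝ q z := by fun_prop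
  refine tendsto_order.2 ⟨fun a ha => ?_, fun a ha => ?_⟩
  -- Lower semicontinuity: the part of `A` at height at most `a` has closed projection, missing
  -- `x₀`.
  · have hC : IsCompact (A ∩ {z | inner ℝ q z ≤ a}) :=
      hA.inter_right (isClosed_le hinner continuous_const)
    have hnot : x₀ ∉ projHyperplane q '' (A ∩ {z | inner ℝ q z ≤ a}) := by
      rintro ⟨z, ⟨hzA, hza⟩, rfl⟩
      refine ha.not_ge (((hleast _ hx₀).2 ?_).trans hza)
      rw [mem_ofPred_eq, coe_projHyperplane_add hq]
      exact hzA
    filter_upwards [mem_nhdsWithin_of_mem_nhds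
      ((hC.image (projHyperplane q).continuous).isClosed.isOpen_compl.mem_nhds hnot),
      self_mem_nhdsWithin] with x hx hxA
    by_contra hcon
    refine hx ⟨_, ⟨(hleast x hxA).1, ?_⟩, projHyperplane_coe_add_smul hq _ _⟩
    rw [mem_ofPred_eq, inner_coe_add_smul hq]
    exact not_lt.1 hcon
  -- Upper semicontinuity: openness at the lowest point over `x₀` yields points below height `a`
  -- over all nearby `x`.
  · have hU : {z : EuclideanSpace ℝ (Fin n) | inner ℝ q z < a} ∈
        𝓝 ((x₀ : EuclideanSpace ℝ (Fin n)) + lowerFunction A q x₀ • q) := by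
      refine (isOpen_lt hinner continuous_const).mem_nhds ?_
      rw [mem_ofPred_eq, inner_coe_add_smul hq]
      exact ha
    have h1 := hopen _ (hleast _ hx₀).1 _ hU
    rw [projHyperplane_coe_add_smul hq] at h1
    filter_upwards [h1]
    rintro _ ⟨z, ⟨hzA, hza⟩, rfl⟩
    refine lt_of_le_of_lt ((hleast _ (mem_image_of_mem _ hzA)).2 ?_) hza
    rw [mem_ofPred_eq, coe_projHyperplane_add hq]
    exact hzA

end Projection

theorem theorem2 (n : ℕ) (A : Set (EuclideanSpace ℝ (Fin n)))
    (hconv : Convex ℝ A) (hcomp : IsCompact A) :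
    IsPSet A ↔
      ∀ (m : ℕ) (L : EuclideanSpace ℝ (Fin n) →ₗ[ℝ] EuclideanSpace ℝ (Fin m)),
        IsOpenMap (Set.imageFactorization L A) := by
  constructor
  · intro hA m L
    exact isOpenMap_imageFactorization_iff.2 fun z hz U hU =>
      hA.image_linearMap_mem_nhdsWithin L hz hU
  · refine fun h => ⟨hconv, hcomp, fun q hq => continuousOn_lowerFunction hcomp hq ?_⟩
    intro z hz U hU
    -- The hyperplane is embedded back in the ambient space so that the hypothesis applies with `m =
    -- n`.
    have h1 := isOpenMap_imageFactorization_iff.1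
      (h n ((orthHyperplane q).subtype ∘ₗ (projHyperplane q).toLinearMap)) z hz U hU
    simp only [LinearMap.coe_comp, Submodule.coe_subtype, ContinuousLinearMap.coe_coe,
      image_comp, Function.comp_apply] at h1
    rw [← preimage_image_eq (projHyperplane q '' (A ∩ U)) Subtype.val_injective]
    exact continuous_subtype_val.continuousWithinAt.tendsto_nhdsWithin (mapsTo_image _ _) h1
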